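/- For a commutative ring $R$ let $V_R=\{x(u,v)=x_1u^3+x_2u^2v+x_3uv^2+x_4v^3 : x_i\in R\}\cong R^4$ be the space of binary cubic forms, with the twisted action of $\mathrm{GL}_2(R)$ given by $$(g\cdot x)(u,v)=\frac1{\det g}\,x(\alpha u+\gamma v,\beta u+\delta v),\qquad g=\begin{pmatrix}\alpha&\beta\\ \gamma&\delta\end{pmatrix}.$$ Let $V_R^*$ be the dual space, with dual coordinates and canonical pairing $[x,y]=x_1y_1+x_2y_2+x_3y_3+x_4y_4$. If $3$ is invertible in $R$, identify $V_R^*$ with $V_R$ by the isomorphism $\iota(y_1,y_2,y_3,y_4)=(y_4,-3y_3,3y_2,-y_1)$. Let $p\neq 2,3$ be a prime, $R=\mathbb Z/p^2\mathbb Z$, $V_{p^2}=V_R$, $V_p=V_{\mathbb F_p}$, $pR^\times=\{pu: u\in R^\times\}$. A form $a\in V_p$ is of type $(0)$ if $a=0$; of type $(1^3)$ if it has a triple root in $\mathbb P^1(\mathbb F_p)$; of type $(1^21)$ if it has one double and one single root in $\mathbb P^1(\mathbb F_p)$; of type $(111)$ if it has three distinct single roots in $\mathbb P^1(\mathbb F_p)$;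 of type $(21)$ if it has exactly one root in $\mathbb P^1(\mathbb F_p)$ and this root is single; of type $(3)$ if it has no root in $\mathbb P^1(\mathbb F_p)$. A form in $V_{p^2}$ is of type $(\sigma)$, for $(\sigma)=(1^21_*),(1^3_{\max}),(1^3_*),(1^3_{**})$, if its $\mathrm{GL}_2(R)$-orbit meets, respectively, $$\begin{aligned} &\{(0,a_2,a_3,0): a_2\in R^\times,\ a_3\in pR\},\\ &\{(a_1,a_2,a_3,a_4): a_1\in R^\times,\ a_2,a_3\in pR,\ a_4\in pR^\times\},\\ &\{(a_1,a_2,a_3,0): a_1\in R^\times,\ a_2\in pR,\ a_3\in pR^\times\},\\ &\{(a_1,a_2,0,0): a_1\in R^\times,\ a_2\in pR\}. \end{aligned}$$ Let $\Phi_p:V_{p^2}\to\mathbb C$ be the characteristic function of the set of forms that are nonmaximal at $p$, that is, of the union of $pV_{p^2}$ and the sets of forms of types $(1^3_{**})$, $(1^3_*)$ and $(1^21_*)$. Its Fourier transform is $$\widehat{\Phi_p}(b)=p^{-8}\sum_{a\in V_{p^2}}\Phi_p(a)\exp\!\left(2\pi i\,[a,b]/p^2\right),$$ a function of $b\in V_{p^2}^*$,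 regarded as a function of $b\in V_{p^2}$ through $\iota$. Then the following hold. (1) Let $b\in pV_{p^2}$; write $b=pb'$ and regard $b'$ as an element of $V_p$. Then $$\widehat{\Phi_p}(pb')=\begin{cases}p^{-2}+p^{-3}-p^{-5}& b'\text{ of type }(0),\\ p^{-3}-p^{-5}& b'\text{ of type }(1^3)\text{ or }(1^21),\\ -p^{-5}& b'\text{ of type }(111),(21)\text{ or }(3).\end{cases}$$ (2) For $b\in V_{p^2}\setminus pV_{p^2}$, $$\widehat{\Phi_p}(b)=\begin{cases}p^{-3}-p^{-5}& b\text{ of type }(1^3_{**}),\\ -p^{-5}& b\text{ of type }(1^3_*)\text{ or }(1^3_{\max}),\\ 0&\text{otherwise.}\end{cases}$$ -/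

import Mathlib

namespace BinaryCubic

/-- The space `V` over `R`: the vector `x` stands for the binary cubic form
`x 0 * u ^ 3 + x 1 * u ^ 2 * v + x 2 * u * v ^ 2 + x 3 * v ^ 3`. -/
abbrev Form (R : Type*) : Type _ := Fin 4 → R

/-- The dual space of `V` over `R`, in dual coordinates. -/
abbrev DualForm (R : Type*) : Type _ := Fin 4 → R

/-- The form as a polynomial in the variables `u = X 0` and `v = X 1`. -/
noncomputable def toPoly {R : Type*} [CommRing R] (x : Form R) : MvPolynomial (Fin 2) R :=
  MvPolynomial.C (x 0) * MvPolynomial.X 0 ^ 3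
    + MvPolynomial.C (x 1) * MvPolynomial.X 0 ^ 2 * MvPolynomial.X 1
    + MvPolynomial.C (x 2) * MvPolynomial.X 0 * MvPolynomial.X 1 ^ 2
    + MvPolynomial.C (x 3) * MvPolynomial.X 1 ^ 3

/-- The twisted action of `GL₂(R)` in coordinates: for `g = !![α, β; γ, δ]`,
`(g • x)(u, v) = (det g)⁻¹ * x(α u + γ v, β u + δ v)`; see `toPoly_act`. -/
def act {R : Type*} [CommRing R] (g : Matrix.GeneralLinearGroup (Fin 2) R) (x : Form R) :
    Form R :=
  let α : R := g.1 0 0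
  let β : R := g.1 0 1
  let γ : R := g.1 1 0
  let δ : R := g.1 1 1
  let e : R := ((Matrix.GeneralLinearGroup.det g)⁻¹ : Rˣ)
  ![e * (α ^ 3 * x 0 + α ^ 2 * β * x 1 + α * β ^ 2 * x 2 + β ^ 3 * x 3),
    e * (3 * α ^ 2 * γ * x 0 + (α ^ 2 * δ + 2 * α * β * γ) * x 1
      + (β ^ 2 * γ + 2 * α * β * δ) * x 2 + 3 * β ^ 2 * δ * x 3),
    e * (3 * α * γ ^ 2 * x 0 + (β * γ ^ 2 + 2 * α * γ * δ) * x 1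
      + (α * δ ^ 2 + 2 * β * γ * δ) * x 2 + 3 * β * δ ^ 2 * x 3),
    e * (γ ^ 3 * x 0 + γ ^ 2 * δ * x 1 + γ * δ ^ 2 * x 2 + δ ^ 3 * x 3)]

theorem toPoly_act {R : Type*} [CommRing R] (g : Matrix.GeneralLinearGroup (Fin 2) R)
    (x : Form R) :
    toPoly (act g x) =
      MvPolynomial.C (((Matrix.GeneralLinearGroup.det g)⁻¹ : Rˣ) : R) *
        MvPolynomial.aeval
          ![MvPolynomial.C (g.1 0 0) * MvPolynomial.X 0
              + MvPolynomial.C (g.1 1 0) * MvPolynomial.X 1,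
            MvPolynomial.C (g.1 0 1) * MvPolynomial.X 0
              + MvPolynomial.C (g.1 1 1) * MvPolynomial.X 1] (toPoly x) := by
  simp only [toPoly, act, map_add, map_mul, map_pow, MvPolynomial.aeval_X,
    MvPolynomial.algHom_C, MvPolynomial.algebraMap_eq, Matrix.cons_val_zero,
    Matrix.cons_val_one, Matrix.cons_val, map_ofNat]
  ring

/-- The `GL₂(R)`-saturation of a set of forms. -/
def saturation {R : Type*} [CommRing R] (D : Set (Form R)) : Set (Form R) :=
  {x | ∃ g : Matrix.GeneralLinearGroup (Fin 2) R, ∃ d ∈ D, x = act g d}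

/-! ### Types of forms over a field -/

/-- The multiplicity of the point `P = (α : β)` of the projective line as a root of the form:
the multiplicity of the linear form `β u - α v` as a factor of it (infinite for the zero form). -/
noncomputable def rootMult {F : Type*} [Field F] (x : Form F)
    (P : Projectivization F (Fin 2 → F)) : ℕ∞ :=
  emultiplicity
    (MvPolynomial.C (P.rep 1) * MvPolynomial.X 0 - MvPolynomial.C (P.rep 0) * MvPolynomial.X 1)
    (toPoly x)

/-- Type `(0)`: the zero form. -/
def type0 (F : Type*) [Field F] : Set (Form F) := {0}

/-- Type `(1³)`: one triple root. -/
def type1cubed (F : Type*) [Field F] : Set (Form F) :=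
  {x | ∃ P, rootMult x P = 3}

/-- Type `(1²1)`: one double root and one single root. -/
def type1sq1 (F : Type*) [Field F] : Set (Form F) :=
  {x | ∃ P Q, P ≠ Q ∧ rootMult x P = 2 ∧ rootMult x Q = 1}

/-- Type `(111)`: three distinct rational roots. -/
def type111 (F : Type*) [Field F] : Set (Form F) :=
  {x | ∃ P Q S, P ≠ Q ∧ P ≠ S ∧ Q ≠ S ∧
    rootMult x P = 1 ∧ rootMult x Q = 1 ∧ rootMult x S = 1}

/-- Type `(21)`: only one rational root, which is single. -/
def type21 (F : Type*) [Field F] : Set (Form F) :=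
  {x | ∃ P, rootMult x P = 1 ∧ ∀ Q, Q ≠ P → rootMult x Q = 0}

/-- Type `(3)`: no rational root. -/
def type3 (F : Type*) [Field F] : Set (Form F) :=
  {x | ∀ P, rootMult x P = 0}

/-! ### Types of forms over `ℤ/p²ℤ` -/

/-- The ideal `pR` of `R = ℤ/p²ℤ`, as a set. -/
def pR (p : ℕ) : Set (ZMod (p ^ 2)) := {x | ∃ u, x = p * u}

/-- The set `pRˣ = {p u | u ∈ Rˣ}` for `R = ℤ/p²ℤ`. -/
def pRunits (p : ℕ) : Set (ZMod (p ^ 2)) := {x | ∃ u, IsUnit u ∧ x = p * u}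

/-- `pV` over `ℤ/p²ℤ`. -/
def pV (p : ℕ) : Set (Form (ZMod (p ^ 2))) := {x | ∃ y : Form (ZMod (p ^ 2)), x = (p : ZMod (p ^ 2)) • y}

/-- Type `(1²1_*)`. -/
def type1sq1Star (p : ℕ) : Set (Form (ZMod (p ^ 2))) :=
  saturation {a | a 0 = 0 ∧ IsUnit (a 1) ∧ a 2 ∈ pR p ∧ a 3 = 0}

/-- Type `(1³_max)`. -/
def type1cubedMax (p : ℕ) : Set (Form (ZMod (p ^ 2))) :=
  saturation {a | IsUnit (a 0) ∧ a 1 ∈ pR p ∧ a 2 ∈ pR p ∧ a 3 ∈ pRunits p}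

/-- Type `(1³_*)`. -/
def type1cubedStar (p : ℕ) : Set (Form (ZMod (p ^ 2))) :=
  saturation {a | IsUnit (a 0) ∧ a 1 ∈ pR p ∧ a 2 ∈ pRunits p ∧ a 3 = 0}

/-- Type `(1³_**)`. -/
def type1cubedStarStar (p : ℕ) : Set (Form (ZMod (p ^ 2))) :=
  saturation {a | IsUnit (a 0) ∧ a 1 ∈ pR p ∧ a 2 = 0 ∧ a 3 = 0}

/-- The set of the forms over `ℤ/p²ℤ` that are nonmaximal at `p`. -/
def nonmaximal (p : ℕ) : Set (Form (ZMod (p ^ 2))) :=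
  pV p ∪ type1cubedStarStar p ∪ type1cubedStar p ∪ type1sq1Star p

/-- `Φ_p`, the characteristic function of the nonmaximal forms over `ℤ/p²ℤ`. -/
noncomputable def Phi (p : ℕ) : Form (ZMod (p ^ 2)) → ℂ :=
  (nonmaximal p).indicator 1

/-- Reduction modulo `p` of a form over `ℤ/p²ℤ`. -/
def reduce (p : ℕ) (x : Form (ZMod (p ^ 2))) : Form (ZMod p) :=
  fun i => ZMod.castHom (dvd_pow_self p two_ne_zero) (ZMod p) (x i)

/-! ### The finite Fourier transform -/

/-- The canonical pairing between `V` and its dual. -/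
def pairing {R : Type*} [CommRing R] (x : Form R) (y : DualForm R) : R :=
  x 0 * y 0 + x 1 * y 1 + x 2 * y 2 + x 3 * y 3

/-- The finite Fourier transform of a function on `V` over `ℤ/Nℤ`, a function on the dual space.
Here `ZMod.stdAddChar t = exp (2 π i t / N)`. -/
noncomputable def fourier {N : ℕ} [NeZero N] (f : Form (ZMod N) → ℂ) (y : DualForm (ZMod N)) :
    ℂ :=
  ((N : ℂ) ^ 4)⁻¹ * ∑ a : Form (ZMod N), f a * ZMod.stdAddChar (pairing a y)

theorem fourier_eq_exp {N : ℕ} [NeZero N] (f : Form (ZMod N) → ℂ) (y : DualForm (ZMod N)) :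
    fourier f y = ((N : ℂ) ^ 4)⁻¹ * ∑ a : Form (ZMod N),
      f a * Complex.exp (2 * Real.pi * Complex.I * (pairing a y).val / N) := by
  simp only [fourier, ZMod.stdAddChar_apply, ZMod.toCircle_apply]

/-- The equivariant map `ι` from the dual space to `V`. -/
def iota {R : Type*} [CommRing R] (y : DualForm R) : Form R :=
  ![y 3, -3 * y 2, 3 * y 1, -y 0]

/-- The inverse of `ι` over `ℤ/Nℤ` when `3` is invertible; see `iota_iotaInv`. -/
def iotaInv {N : ℕ} (b : Form (ZMod N)) : DualForm (ZMod N) :=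
  ![-b 3, 3⁻¹ * b 2, -(3⁻¹ * b 1), b 0]

theorem iota_iotaInv {N : ℕ} (h : Nat.Coprime 3 N) (b : Form (ZMod N)) :
    iota (iotaInv b) = b := by
  have h3 : (3 : ZMod N) * 3⁻¹ = 1 := by
    simpa using ZMod.coe_mul_inv_eq_one 3 h
  funext i
  fin_cases i
  · simp [iota, iotaInv]
  · simp [iota, iotaInv, ← mul_assoc, h3]
  · simp [iota, iotaInv, ← mul_assoc, h3]
  · simp [iota, iotaInv]

theorem iotaInv_iota {N : ℕ} (h : Nat.Coprime 3 N) (y : DualForm (ZMod N)) :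
    iotaInv (iota y) = y := by
  have h3 : (3⁻¹ : ZMod N) * 3 = 1 := by
    rw [mul_comm]
    simpa using ZMod.coe_mul_inv_eq_one 3 h
  funext i
  fin_cases i
  · simp [iota, iotaInv]
  · simp [iota, iotaInv, ← mul_assoc, h3]
  · simp [iota, iotaInv, ← mul_assoc, h3]
  · simp [iota, iotaInv]

/-- The Fourier transform of `f` as a function on `V` over `ℤ/Nℤ`, when the dual space is
identified with `V` by `ι` (for `N` prime to `3`). -/
noncomputable def fourierV {N : ℕ} [NeZero N] (f : Form (ZMod N) → ℂ) (b : Form (ZMod N)) : ℂ :=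
  fourier f (iotaInv b)

end BinaryCubic

/-! Outside `pV p`, a form is nonmaximal exactly when some translate lies in the box `nonmaximalAt
p`, that is, has a double root at (0 : 1) modulo p and vanishes there modulo p²
(`mem_nonmaximal_iff`). A form that is nonzero modulo p has at most one double root, so at most one
point of the projective line over `ZMod p` is responsible. With g_P of determinant 1 carrying P to
(0 : 1), `Phi_eq` writes Φ_p as the indicator of pV plus the sum over the p + 1 points P of the
indicator of `nonmaximalAt p` minus that of `nonmaximalAt p ∩ pV p`, both composed with g_P.

Each term is the indicator of a box, whose transform is a constant times the indicator of a dual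
box: p⁻⁴ on pV, p⁻³ on `strongTripleRoot p`, p⁻⁵ on `tripleRoot p`. The transform commutes with
matrices of determinant 1 (`fourierV_act`), so its value at b is a count of points P
(`fourierV_Phi`). At b = pc it is p⁻³ times the number of double roots of c modulo p, minus p⁻⁵;
that number is p + 1, 1 or 0. Outside pV at most one P contributes to either sum, and the types of
triple-root forms tell which sums are nonzero. -/

namespace BinaryCubic

set_option linter.unusedSectionVars false

/-! ### Arithmetic of `ℤ/p²ℤ` -/

section Arithmetic

variable {p : ℕ} [hp : Fact p.Prime]

/-- Reduction `ℤ/p²ℤ → ℤ/pℤ`. -/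
def red (p : ℕ) : ZMod (p ^ 2) →+* ZMod p :=
  ZMod.castHom (dvd_pow_self p two_ne_zero) (ZMod p)

theorem mul_eq_zero_iff_red (x : ZMod (p ^ 2)) : (p : ZMod (p ^ 2)) * x = 0 ↔ red p x = 0 := by
  obtain ⟨n, rfl⟩ := ZMod.natCast_zmod_surjective x
  rw [map_natCast, ZMod.natCast_eq_zero_iff, ← Nat.cast_mul, ZMod.natCast_eq_zero_iff, sq]
  exact Nat.mul_dvd_mul_iff_left hp.out.pos

theorem mem_pR_iff (x : ZMod (p ^ 2)) : x ∈ pR p ↔ red p x = 0 := by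
  constructor
  · rintro ⟨u, rfl⟩
    simp
  · intro h
    obtain ⟨n, rfl⟩ := ZMod.natCast_zmod_surjective x
    rw [map_natCast, ZMod.natCast_eq_zero_iff] at h
    obtain ⟨m, rfl⟩ := h
    exact ⟨m, by simp⟩

theorem isUnit_iff_red (x : ZMod (p ^ 2)) : IsUnit x ↔ red p x ≠ 0 := by
  obtain ⟨n, rfl⟩ := ZMod.natCast_zmod_surjective x
  rw [map_natCast, Ne, ZMod.natCast_eq_zero_iff, ZMod.isUnit_iff_coprime,
    Nat.coprime_pow_right_iff two_pos, Nat.coprime_comm, hp.out.coprime_iff_not_dvd]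

theorem mem_pRunits_iff (x : ZMod (p ^ 2)) : x ∈ pRunits p ↔ red p x = 0 ∧ x ≠ 0 := by
  constructor
  · rintro ⟨u, hu, rfl⟩
    refine ⟨by simp, fun h => ?_⟩
    exact (isUnit_iff_red u).1 hu ((mul_eq_zero_iff_red u).1 h)
  · rintro ⟨h, h0⟩
    obtain ⟨u, rfl⟩ := (mem_pR_iff x).2 h
    exact ⟨u, (isUnit_iff_red u).2 fun hu => h0 ((mul_eq_zero_iff_red u).2 hu), rfl⟩

theorem mul_eq_zero_of_red {x y : ZMod (p ^ 2)} (hx : red p x = 0) (hy : red p y = 0) :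
    x * y = 0 := by
  obtain ⟨u, rfl⟩ := (mem_pR_iff x).2 hx
  rw [mul_assoc, mul_eq_zero_iff_red, map_mul, hy, mul_zero]

theorem mem_pV_iff (x : Form (ZMod (p ^ 2))) : x ∈ pV p ↔ ∀ i, red p (x i) = 0 := by
  constructor
  · rintro ⟨y, rfl⟩ i
    simp
  · intro h
    choose y hy using fun i => (mem_pR_iff (x i)).2 (h i)
    exact ⟨y, funext hy⟩

theorem mem_pV_iff_four (x : Form (ZMod (p ^ 2))) :
    x ∈ pV p ↔ red p (x 0) = 0 ∧ red p (x 1) = 0 ∧ red p (x 2) = 0 ∧ red p (x 3) = 0 := by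
  rw [mem_pV_iff, Fin.forall_fin_succ, Fin.forall_fin_succ, Fin.forall_fin_two]
  rfl

end Arithmetic

/-! ### The action -/

section Action

variable {R : Type*} [CommRing R]

theorem det_inv_mul (g : Matrix.GeneralLinearGroup (Fin 2) R) :
    (((Matrix.GeneralLinearGroup.det g)⁻¹ : Rˣ) : R)
      * (g.1 0 0 * g.1 1 1 - g.1 0 1 * g.1 1 0) = 1 := by
  rw [← Matrix.det_fin_two, ← Matrix.GeneralLinearGroup.val_det_apply, Units.inv_mul]

theorem act_one (x : Form R) : act 1 x = x := by
  funext i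
  fin_cases i <;> simp [act]

theorem act_mul (g h : Matrix.GeneralLinearGroup (Fin 2) R) (x : Form R) :
    act (g * h) x = act g (act h x) := by
  funext i
  fin_cases i <;> simp [act, Matrix.mul_apply, Fin.sum_univ_two] <;> ring

theorem act_inv_act (g : Matrix.GeneralLinearGroup (Fin 2) R) (x : Form R) :
    act g⁻¹ (act g x) = x := by
  rw [← act_mul, inv_mul_cancel, act_one]

theorem act_act_inv (g : Matrix.GeneralLinearGroup (Fin 2) R) (x : Form R) :
    act g (act g⁻¹ x) = x := by
  rw [← act_mul, mul_inv_cancel, act_one]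

theorem act_smul (g : Matrix.GeneralLinearGroup (Fin 2) R) (c : R) (x : Form R) :
    act g (c • x) = c • act g x := by
  funext i
  fin_cases i <;> simp [act] <;> ring

/-- The action of an invertible matrix as a permutation of the forms. -/
def actEquiv (g : Matrix.GeneralLinearGroup (Fin 2) R) : Form R ≃ Form R where
  toFun := act g
  invFun := act g⁻¹
  left_inv := act_inv_act g
  right_inv := act_act_inv g

theorem mem_saturation_iff (S : Set (Form R)) (x : Form R) :
    x ∈ saturation S ↔ ∃ g, act g x ∈ S := by
  constructor
  · rintro ⟨g, d, hd, rfl⟩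
    exact ⟨g⁻¹, by rwa [act_inv_act]⟩
  · rintro ⟨g, hg⟩
    exact ⟨g⁻¹, _, hg, (act_inv_act g x).symm⟩

theorem act_mem_saturation {S : Set (Form R)} (g : Matrix.GeneralLinearGroup (Fin 2) R)
    {x : Form R} (h : act g x ∈ saturation S) : x ∈ saturation S := by
  rw [mem_saturation_iff] at h ⊢
  obtain ⟨k, hk⟩ := h
  exact ⟨k * g, by rwa [act_mul]⟩

theorem saturation_mono {S T : Set (Form R)} (h : S ⊆ T) : saturation S ⊆ saturation T := by
  rintro x ⟨g, d, hd, rfl⟩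
  exact ⟨g, d, h hd, rfl⟩

end Action

/-! ### Double roots modulo p and cosets of the Iwahori subgroup. -/

section Iwahori

variable {p : ℕ} [hp : Fact p.Prime]

theorem act_mem_pV {x : Form (ZMod (p ^ 2))} (g : Matrix.GeneralLinearGroup (Fin 2) (ZMod (p ^ 2)))
    (h : x ∈ pV p) : act g x ∈ pV p := by
  obtain ⟨y, rfl⟩ := h
  exact ⟨act g y, act_smul g _ y⟩

theorem act_mem_pV_iff {x : Form (ZMod (p ^ 2))}
    (g : Matrix.GeneralLinearGroup (Fin 2) (ZMod (p ^ 2))) : act g x ∈ pV p ↔ x ∈ pV p :=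
  ⟨fun h => by simpa only [act_inv_act] using act_mem_pV g⁻¹ h, act_mem_pV g⟩

/-- Forms with a double root at the point `(0 : 1)` modulo `p`. -/
def doubleRoot (p : ℕ) : Set (Form (ZMod (p ^ 2))) := {x | red p (x 2) = 0 ∧ red p (x 3) = 0}

/-- Forms with a double root at the point `(0 : 1)` modulo `p` that vanish there modulo `p²`. -/
def nonmaximalAt (p : ℕ) : Set (Form (ZMod (p ^ 2))) := {x | red p (x 2) = 0 ∧ x 3 = 0}

/-- Forms with a triple root at the point `(0 : 1)` modulo `p` (or zero modulo `p`). -/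
def tripleRoot (p : ℕ) : Set (Form (ZMod (p ^ 2))) :=
  {x | red p (x 1) = 0 ∧ red p (x 2) = 0 ∧ red p (x 3) = 0}

/-- Forms with a triple root at `(0 : 1)` modulo `p` and a double root there modulo `p²`. -/
def strongTripleRoot (p : ℕ) : Set (Form (ZMod (p ^ 2))) :=
  {x | red p (x 1) = 0 ∧ x 2 = 0 ∧ x 3 = 0}

/-- Stability under the matrices that are upper triangular modulo `p`. -/
def IwahoriStable (S : Set (Form (ZMod (p ^ 2)))) : Prop :=
  ∀ g : Matrix.GeneralLinearGroup (Fin 2) (ZMod (p ^ 2)), red p (g.1 1 0) = 0 →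
    ∀ x ∈ S, act g x ∈ S

theorem iwahoriStable_nonmaximalAt : IwahoriStable (nonmaximalAt p) := by
  rintro g hg x ⟨h2, h3⟩
  have e1 : g.1 1 0 * g.1 1 0 = 0 := mul_eq_zero_of_red hg hg
  have e2 : g.1 1 0 * x 2 = 0 := mul_eq_zero_of_red hg h2
  refine ⟨?_, ?_⟩
  · simp [act, hg, h2, h3]
  · simp only [act, Matrix.cons_val, h3]
    linear_combination (((Matrix.GeneralLinearGroup.det g)⁻¹ : (ZMod (p ^ 2))ˣ) : ZMod (p ^ 2))
      * ((g.1 1 0 * x 0 + g.1 1 1 * x 1) * e1 + g.1 1 1 ^ 2 * e2)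

theorem iwahoriStable_tripleRoot : IwahoriStable (tripleRoot p) := by
  rintro g hg x ⟨h1, h2, h3⟩
  refine ⟨?_, ?_, ?_⟩ <;> simp [act, hg, h1, h2, h3]

theorem iwahoriStable_strongTripleRoot : IwahoriStable (strongTripleRoot p) := by
  rintro g hg x ⟨h1, h2, h3⟩
  have e1 : g.1 1 0 * g.1 1 0 = 0 := mul_eq_zero_of_red hg hg
  have e2 : g.1 1 0 * x 1 = 0 := mul_eq_zero_of_red hg h1
  refine ⟨?_, ?_, ?_⟩
  · simp [act, hg, h1, h2, h3]
  · simp only [act, Matrix.cons_val, h2, h3]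
    linear_combination (((Matrix.GeneralLinearGroup.det g)⁻¹ : (ZMod (p ^ 2))ˣ) : ZMod (p ^ 2))
      * (3 * g.1 0 0 * x 0 * e1 + (g.1 0 1 * g.1 1 0 + 2 * g.1 0 0 * g.1 1 1) * e2)
  · simp only [act, Matrix.cons_val, h2, h3]
    linear_combination (((Matrix.GeneralLinearGroup.det g)⁻¹ : (ZMod (p ^ 2))ˣ) : ZMod (p ^ 2))
      * (g.1 1 0 * x 0 * e1 + g.1 1 0 * g.1 1 1 * e2)

theorem iwahoriStable_doubleRoot : IwahoriStable (doubleRoot p) := by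
  rintro g hg x ⟨h2, h3⟩
  refine ⟨?_, ?_⟩ <;> simp [act, hg, h2, h3]

theorem nonmaximalAt_subset : nonmaximalAt p ⊆ doubleRoot p :=
  fun _ h => ⟨h.1, by simp [h.2]⟩

theorem tripleRoot_subset : tripleRoot p ⊆ doubleRoot p := fun _ h => h.2

theorem strongTripleRoot_subset_tripleRoot : strongTripleRoot p ⊆ tripleRoot p :=
  fun _ h => ⟨h.1, by simp [h.2.1], by simp [h.2.2]⟩

theorem strongTripleRoot_subset : strongTripleRoot p ⊆ doubleRoot p :=
  strongTripleRoot_subset_tripleRoot.trans tripleRoot_subset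

/-- A nonzero cubic form over `ZMod p` has at most one double root. The lower row of `g` is the
point that `g` moves to (0 : 1), so it must be (0 : 1) itself. -/
theorem red_lower_left_eq_zero {x : Form (ZMod (p ^ 2))} (hx : x ∈ doubleRoot p)
    (hV : x ∉ pV p) {g : Matrix.GeneralLinearGroup (Fin 2) (ZMod (p ^ 2))}
    (hg : act g x ∈ doubleRoot p) : red p (g.1 1 0) = 0 := by
  obtain ⟨h2, h3⟩ := hx
  obtain ⟨k2, k3⟩ := hg
  have hd := congrArg (red p) (det_inv_mul g)
  simp only [act, Matrix.cons_val, map_mul, map_add, map_pow, h2, h3, map_ofNat] at k2 k3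
  simp only [map_mul, map_sub, map_one] at hd
  set e := red p (((Matrix.GeneralLinearGroup.det g)⁻¹ : (ZMod (p ^ 2))ˣ) : ZMod (p ^ 2))
  set a := red p (g.1 0 0)
  set b := red p (g.1 0 1)
  set c := red p (g.1 1 0)
  set d := red p (g.1 1 1)
  have he : e ≠ 0 := left_ne_zero_of_mul_eq_one hd
  by_contra hc
  have q3 : c * red p (x 0) + d * red p (x 1) = 0 := by
    have : (e * c ^ 2) * (c * red p (x 0) + d * red p (x 1)) = 0 := by linear_combination k3
    exact (mul_eq_zero.1 this).resolve_left (by positivity)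
  -- Eliminating `x 0` from `k2` by means of `q3` leaves `x 1` times `-c` times the determinant, so
  -- neither 2 nor 3 has to be inverted.
  have q1 : red p (x 1) = 0 := by
    have : c * red p (x 1) = 0 := by
      linear_combination (-c * red p (x 1)) * hd - k2 + e * 3 * a * c * q3
    exact (mul_eq_zero.1 this).resolve_left hc
  have q0 : red p (x 0) = 0 := by
    rw [q1, mul_zero, add_zero] at q3
    exact (mul_eq_zero.1 q3).resolve_left hc
  exact hV ((mem_pV_iff_four x).2 ⟨q0, q1, h2, h3⟩)

/-- Matrices of determinant one that move the points of the projective line over `ℤ/pℤ`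
to `(0 : 1)`. -/
noncomputable def pointSL (p : ℕ) :
    Option (ZMod p) → Matrix.SpecialLinearGroup (Fin 2) (ZMod (p ^ 2))
  | none => ⟨!![0, -1; 1, 0], by simp⟩
  | some t => ⟨!![1, 0; (t.cast : ZMod (p ^ 2)), 1], by simp⟩

/-- The matrices of `pointSL` as elements of `GL₂`. -/
noncomputable def pointGL (p : ℕ) (P : Option (ZMod p)) :
    Matrix.GeneralLinearGroup (Fin 2) (ZMod (p ^ 2)) :=
  (pointSL p P : Matrix.GeneralLinearGroup (Fin 2) (ZMod (p ^ 2)))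

theorem pointGL_none : (pointGL p none).1 = !![0, -1; 1, 0] := rfl

theorem pointGL_some (t : ZMod p) :
    (pointGL p (some t)).1 = !![1, 0; (t.cast : ZMod (p ^ 2)), 1] := rfl

theorem det_pointGL (P : Option (ZMod p)) :
    Matrix.GeneralLinearGroup.det (pointGL p P) = 1 := by
  simp [pointGL]

/-- Together with `eq_of_mul_pointGL`: the matrices `pointGL p P` represent, once each, the cosets
of the matrices that are upper triangular modulo p. -/
theorem exists_pointGL_mul (g : Matrix.GeneralLinearGroup (Fin 2) (ZMod (p ^ 2))) :
    ∃ P, red p ((pointGL p P * g).1 1 0) = 0 := by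
  by_cases h : red p (g.1 0 0) = 0
  · exact ⟨none, by simp [pointGL_none, Matrix.mul_apply, Fin.sum_univ_two, h]⟩
  · refine ⟨some (-red p (g.1 1 0) / red p (g.1 0 0)), ?_⟩
    simp [pointGL_some, Matrix.mul_apply, Fin.sum_univ_two, h]

theorem eq_of_mul_pointGL {P Q : Option (ZMod p)}
    {g : Matrix.GeneralLinearGroup (Fin 2) (ZMod (p ^ 2))} (hg : red p (g.1 1 0) = 0)
    (h : g * pointGL p P = pointGL p Q) : P = Q := by
  have h0 := congrArg (fun k => red p (k.1 1 0)) h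
  have h1 := congrArg (fun k => red p (k.1 1 1)) h
  rcases P with _ | s <;> rcases Q with _ | t <;>
    simp [pointGL_none, pointGL_some, Matrix.mul_apply, Fin.sum_univ_two, hg] at h0 h1 ⊢
  · simp [h1] at h0
  · simpa [h1] using h0

theorem mem_saturation_iff_pointGL {S : Set (Form (ZMod (p ^ 2)))} (hS : IwahoriStable S)
    (x : Form (ZMod (p ^ 2))) : x ∈ saturation S ↔ ∃ P, act (pointGL p P) x ∈ S := by
  constructor
  · rintro ⟨g, d, hd, rfl⟩
    obtain ⟨P, hP⟩ := exists_pointGL_mul g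
    exact ⟨P, by rw [← act_mul]; exact hS _ hP d hd⟩
  · rintro ⟨P, hP⟩
    exact (mem_saturation_iff S x).2 ⟨_, hP⟩

theorem pointGL_unique {x : Form (ZMod (p ^ 2))} (hV : x ∉ pV p) {P Q : Option (ZMod p)}
    (hP : act (pointGL p P) x ∈ doubleRoot p) (hQ : act (pointGL p Q) x ∈ doubleRoot p) :
    P = Q := by
  refine eq_of_mul_pointGL (g := pointGL p Q * (pointGL p P)⁻¹) ?_ (by group)
  refine red_lower_left_eq_zero hP (by rwa [act_mem_pV_iff]) ?_
  rwa [act_mul, act_inv_act]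

-- Existence of P comes from the coset representatives, uniqueness from the double root; this turns
-- membership in an orbit into a sum over points.
open Classical in
theorem sum_pointGL {S : Set (Form (ZMod (p ^ 2)))} (hS : IwahoriStable S)
    (hD : S ⊆ doubleRoot p) {x : Form (ZMod (p ^ 2))} (hV : x ∉ pV p) :
    ∑ P, (if act (pointGL p P) x ∈ S then (1 : ℂ) else 0) = if x ∈ saturation S then 1 else 0 := by
  split_ifs with h
  · obtain ⟨P, hP⟩ := (mem_saturation_iff_pointGL hS x).1 h
    rw [Finset.sum_eq_single P, if_pos hP]
    · intro Q _ hQ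
      rw [if_neg fun h' => hQ (pointGL_unique hV (hD h') (hD hP))]
    · simp
  · refine Finset.sum_eq_zero fun P _ => if_neg fun hP => h ?_
    exact (mem_saturation_iff_pointGL hS x).2 ⟨P, hP⟩

end Iwahori

/-! ### Nonmaximal forms and the types of forms with a triple root -/

section Types

variable {p : ℕ} [hp : Fact p.Prime]

/-- The upper triangular unipotent matrix with upper right entry `b`. -/
def upperUnipotent {R : Type*} [CommRing R] (b : R) : Matrix.GeneralLinearGroup (Fin 2) R :=
  let s : Matrix.SpecialLinearGroup (Fin 2) R := ⟨!![1, b; 0, 1], by simp⟩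
  (s : Matrix.GeneralLinearGroup (Fin 2) R)

theorem upperUnipotent_val {R : Type*} [CommRing R] (b : R) :
    (upperUnipotent b).1 = !![1, b; 0, 1] := rfl

theorem det_upperUnipotent {R : Type*} [CommRing R] (b : R) :
    Matrix.GeneralLinearGroup.det (upperUnipotent b) = 1 := by
  refine Units.ext ?_
  rw [Matrix.GeneralLinearGroup.val_det_apply, upperUnipotent_val]
  simp

theorem act_upperUnipotent {R : Type*} [CommRing R] (b : R) (x : Form R) :
    act (upperUnipotent b) x = ![x 0 + b * x 1 + b ^ 2 * x 2 + b ^ 3 * x 3,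
      x 1 + 2 * b * x 2 + 3 * b ^ 2 * x 3, x 2 + 3 * b * x 3, x 3] := by
  simp [act, det_upperUnipotent, upperUnipotent_val]

theorem mem_saturation_of_mem {R : Type*} [CommRing R] {S : Set (Form R)} {x : Form R}
    (h : x ∈ S) : x ∈ saturation S :=
  (mem_saturation_iff S x).2 ⟨1, by rwa [act_one]⟩

theorem mem_type1sq1Star {x : Form (ZMod (p ^ 2))} (hx : x ∈ nonmaximalAt p)
    (h1 : red p (x 1) ≠ 0) : x ∈ type1sq1Star p := by
  obtain ⟨h2, h3⟩ := hx
  obtain ⟨v, hv⟩ := ((isUnit_iff_red _).2 h1).exists_right_inv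
  have e2 : x 2 * x 2 = 0 := mul_eq_zero_of_red h2 h2
  -- The witness solves `x 0 + b * x 1 + b ^ 2 * x 2 = 0`: one Newton step from `-(x 0 * v)`, exact
  -- because `x 2 * x 2 = 0`.
  refine (mem_saturation_iff _ x).2 ⟨upperUnipotent (-(x 0 * v) - x 0 ^ 2 * v ^ 3 * x 2), ?_⟩
  rw [act_upperUnipotent]
  refine ⟨?_, ?_, ?_, ?_⟩
  · simp only [Matrix.cons_val, h3]
    linear_combination (-x 0 - x 0 ^ 2 * v ^ 2 * x 2) * hv
      + (2 * x 0 ^ 3 * v ^ 4 + x 0 ^ 4 * v ^ 6 * x 2) * e2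
  · simp [isUnit_iff_red, h1, h2, h3]
  · simp [mem_pR_iff, h2, h3]
  · simp [h3]

theorem type1cubedStarStar_eq (x : Form (ZMod (p ^ 2))) (hV : x ∉ pV p) :
    x ∈ type1cubedStarStar p ↔ x ∈ saturation (strongTripleRoot p) := by
  constructor
  · refine fun h => saturation_mono ?_ h
    rintro a ⟨_, h1, h2, h3⟩
    exact ⟨(mem_pR_iff _).1 h1, h2, h3⟩
  · rintro ⟨g, d, ⟨h1, h2, h3⟩, rfl⟩
    refine ⟨g, d, ⟨?_, (mem_pR_iff _).2 h1, h2, h3⟩, rfl⟩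
    rw [act_mem_pV_iff, mem_pV_iff_four] at hV
    rw [isUnit_iff_red]
    exact fun h0 => hV ⟨h0, h1, by simp [h2], by simp [h3]⟩

theorem not_mem_pV_of_isUnit {x : Form (ZMod (p ^ 2))} {i : Fin 4} (h : IsUnit (x i)) :
    x ∉ pV p := fun hx => (isUnit_iff_red _).1 h ((mem_pV_iff x).1 hx i)

theorem type1cubedStar_or_max_subset :
    type1cubedStar p ∪ type1cubedMax p ⊆ saturation (tripleRoot p) := by
  rintro x (h | h)
  · refine saturation_mono ?_ h
    rintro a ⟨_, h1, h2, h3⟩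
    exact ⟨(mem_pR_iff _).1 h1, ((mem_pRunits_iff _).1 h2).1, by simp [h3]⟩
  · refine saturation_mono ?_ h
    rintro a ⟨_, h1, h2, h3⟩
    exact ⟨(mem_pR_iff _).1 h1, (mem_pR_iff _).1 h2, ((mem_pRunits_iff _).1 h3).1⟩

/-- A matrix between two forms with their double root at (0 : 1) is upper triangular modulo p, and
such matrices preserve `strongTripleRoot p`; hence the conditions `d 2 = 0` and `d 3 = 0` can be
tested on the representative `d`. -/
theorem not_mem_strongTripleRoot_of_star_or_max {x : Form (ZMod (p ^ 2))}
    (h : x ∈ type1cubedStar p ∪ type1cubedMax p) : x ∉ saturation (strongTripleRoot p) := by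
  have key : ∀ d : Form (ZMod (p ^ 2)), IsUnit (d 0) → d ∈ tripleRoot p →
      ¬ (d 2 = 0 ∧ d 3 = 0) → ∀ g, act g d ∉ saturation (strongTripleRoot p) := by
    intro d h0 hd hn g hg
    obtain ⟨k, hk⟩ := (mem_saturation_iff _ d).1 (act_mem_saturation g hg)
    have hdk : act k⁻¹ (act k d) = d := act_inv_act k d
    have hk' : red p (k⁻¹.1 1 0) = 0 := by
      refine red_lower_left_eq_zero (strongTripleRoot_subset hk) ?_ ?_
      · rw [act_mem_pV_iff]
        exact not_mem_pV_of_isUnit h0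
      · rw [hdk]
        exact tripleRoot_subset hd
    have hd' := iwahoriStable_strongTripleRoot _ hk' _ hk
    rw [hdk] at hd'
    exact hn hd'.2
  rcases h with ⟨g, d, ⟨h0, h1, h2, h3⟩, rfl⟩ | ⟨g, d, ⟨h0, h1, h2, h3⟩, rfl⟩
  · have h2' := (mem_pRunits_iff _).1 h2
    exact key d h0 ⟨(mem_pR_iff _).1 h1, h2'.1, by simp [h3]⟩ (fun h => h2'.2 h.1) g
  · have h3' := (mem_pRunits_iff _).1 h3
    exact key d h0 ⟨(mem_pR_iff _).1 h1, (mem_pR_iff _).1 h2, h3'.1⟩ (fun h => h3'.2 h.2) g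

theorem mem_of_mem_saturation_tripleRoot {x : Form (ZMod (p ^ 2))} (hV : x ∉ pV p)
    (h : x ∈ saturation (tripleRoot p)) :
    x ∈ type1cubedStarStar p ∪ type1cubedStar p ∪ type1cubedMax p := by
  obtain ⟨g, d, ⟨h1, h2, h3⟩, rfl⟩ := h
  rw [act_mem_pV_iff, mem_pV_iff_four] at hV
  have h0 : IsUnit (d 0) := by
    rw [isUnit_iff_red]
    exact fun h0 => hV ⟨h0, h1, h2, h3⟩
  have h1' := (mem_pR_iff _).2 h1
  by_cases k3 : d 3 = 0
  · left
    by_cases k2 : d 2 = 0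
    · exact Or.inl ⟨g, d, ⟨h0, h1', k2, k3⟩, rfl⟩
    · exact Or.inr ⟨g, d, ⟨h0, h1', (mem_pRunits_iff _).2 ⟨h2, k2⟩, k3⟩, rfl⟩
  · exact Or.inr ⟨g, d, ⟨h0, h1', (mem_pR_iff _).2 h2, (mem_pRunits_iff _).2 ⟨h3, k3⟩⟩, rfl⟩

theorem mem_nonmaximal_iff {x : Form (ZMod (p ^ 2))} (hV : x ∉ pV p) :
    x ∈ nonmaximal p ↔ x ∈ saturation (nonmaximalAt p) := by
  constructor
  · rintro (((h | h) | h) | h)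
    · exact absurd h hV
    · refine saturation_mono ?_ h
      rintro a ⟨_, h1, h2, h3⟩
      exact ⟨by simp [h2], h3⟩
    · refine saturation_mono ?_ h
      rintro a ⟨_, h1, h2, h3⟩
      exact ⟨((mem_pRunits_iff _).1 h2).1, h3⟩
    · refine saturation_mono ?_ h
      rintro a ⟨_, h1, h2, h3⟩
      exact ⟨(mem_pR_iff _).1 h2, h3⟩
  · rintro ⟨g, d, hd, rfl⟩
    by_cases h1 : red p (d 1) = 0
    · obtain ⟨h2, h3⟩ := hd
      rw [act_mem_pV_iff, mem_pV_iff_four] at hV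
      have h0 : IsUnit (d 0) := by
        rw [isUnit_iff_red]
        exact fun h0 => hV ⟨h0, h1, h2, by simp [h3]⟩
      by_cases k2 : d 2 = 0
      · exact Or.inl (Or.inl (Or.inr ⟨g, d, ⟨h0, (mem_pR_iff _).2 h1, k2, h3⟩, rfl⟩))
      · exact Or.inl (Or.inr ⟨g, d, ⟨h0, (mem_pR_iff _).2 h1,
          (mem_pRunits_iff _).2 ⟨h2, k2⟩, h3⟩, rfl⟩)
    · refine Or.inr (act_mem_saturation g⁻¹ ?_)
      rw [act_inv_act]
      exact mem_type1sq1Star hd h1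

-- On `pV p` the two indicators under the sum agree and cancel; elsewhere the second one vanishes
-- and the first is counted by `sum_pointGL`.
open Classical in
theorem Phi_eq (x : Form (ZMod (p ^ 2))) :
    Phi p x = (if x ∈ pV p then 1 else 0)
      + ∑ P, ((if act (pointGL p P) x ∈ nonmaximalAt p then 1 else 0)
        - (if act (pointGL p P) x ∈ nonmaximalAt p ∩ pV p then 1 else 0)) := by
  by_cases hV : x ∈ pV p
  · have hx : x ∈ nonmaximal p := Or.inl (Or.inl (Or.inl hV))
    simp [Phi, hx, act_mem_pV_iff, hV]
  · simp [Phi, act_mem_pV_iff, hV, sum_pointGL iwahoriStable_nonmaximalAt nonmaximalAt_subset,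
      Set.indicator_apply, mem_nonmaximal_iff]

end Types

/-! ### Fourier transforms of boxes -/

section Fourier

variable {p : ℕ} [hp : Fact p.Prime]

theorem pairing_act {N : ℕ} (h : Nat.Coprime 3 N)
    (g : Matrix.GeneralLinearGroup (Fin 2) (ZMod N)) (x b : Form (ZMod N)) :
    pairing (act g x) (iotaInv (act g b))
      = (Matrix.GeneralLinearGroup.det g : ZMod N) * pairing x (iotaInv b) := by
  have h3 : (3 : ZMod N) * 3⁻¹ = 1 := by
    simpa using ZMod.coe_mul_inv_eq_one 3 h
  -- Through `iotaInv` the pairing becomes, up to the unit 3, the classical alternating form on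
  -- binary cubics, which is invariant up to the determinant.
  have hB (x b : Form (ZMod N)) : 3 * pairing x (iotaInv b)
      = 3 * (x 3 * b 0 - x 0 * b 3) + x 1 * b 2 - x 2 * b 1 := by
    simp only [pairing, iotaInv, Matrix.cons_val]
    linear_combination (x 1 * b 2 - x 2 * b 1) * h3
  have hu : IsUnit (3 : ZMod N) := IsUnit.of_mul_eq_one _ h3
  have hd := det_inv_mul g
  refine hu.mul_left_cancel ?_
  rw [hB, mul_left_comm, hB, Matrix.GeneralLinearGroup.val_det_apply, Matrix.det_fin_two]
  simp only [act, Matrix.cons_val]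
  set e := (((Matrix.GeneralLinearGroup.det g)⁻¹ : (ZMod N)ˣ) : ZMod N)
  linear_combination (g.1 0 0 * g.1 1 1 - g.1 0 1 * g.1 1 0)
    * (e * (g.1 0 0 * g.1 1 1 - g.1 0 1 * g.1 1 0) + 1)
    * (3 * (x 3 * b 0 - x 0 * b 3) + x 1 * b 2 - x 2 * b 1) * hd

/-- The Fourier transform of the characteristic function of a box. -/
theorem fourier_box {N : ℕ} [NeZero N] (H₀ H₁ H₂ H₃ : ZMod N → Prop) [DecidablePred H₀]
    [DecidablePred H₁] [DecidablePred H₂] [DecidablePred H₃] (y : DualForm (ZMod N)) :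
    fourier (fun a => if H₀ (a 0) ∧ H₁ (a 1) ∧ H₂ (a 2) ∧ H₃ (a 3) then (1 : ℂ) else 0) y
      = ((N : ℂ) ^ 4)⁻¹ *
        ((∑ t, (if H₀ t then (1 : ℂ) else 0) * ZMod.stdAddChar (t * y 0))
        * (∑ t, (if H₁ t then (1 : ℂ) else 0) * ZMod.stdAddChar (t * y 1))
        * (∑ t, (if H₂ t then (1 : ℂ) else 0) * ZMod.stdAddChar (t * y 2))
        * (∑ t, (if H₃ t then (1 : ℂ) else 0) * ZMod.stdAddChar (t * y 3))) := by
  let φ (H : ZMod N → Prop) [DecidablePred H] (z t : ZMod N) : ℂ :=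
    (if H t then (1 : ℂ) else 0) * ZMod.stdAddChar (t * z)
  have h := Finset.prod_univ_sum (fun _ : Fin 4 => (Finset.univ : Finset (ZMod N)))
    (fun i => ![φ H₀ (y 0), φ H₁ (y 1), φ H₂ (y 2), φ H₃ (y 3)] i)
  rw [Fintype.piFinset_univ] at h
  simp only [Fin.prod_univ_four, Matrix.cons_val] at h
  rw [h, fourier]
  refine congrArg _ (Finset.sum_congr rfl fun a _ => ?_)
  simp only [φ, pairing, AddChar.map_add_eq_mul]
  by_cases h0 : H₀ (a 0) <;> by_cases h1 : H₁ (a 1) <;> by_cases h2 : H₂ (a 2) <;>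
    by_cases h3 : H₃ (a 3) <;> simp [h0, h1, h2, h3]

theorem sum_top {N : ℕ} [NeZero N] (y : ZMod N) :
    ∑ t : ZMod N, (if True then (1 : ℂ) else 0) * ZMod.stdAddChar (t * y)
      = if y = 0 then (N : ℂ) else 0 := by
  simp only [if_true, one_mul]
  rw [AddChar.sum_mulShift y (ZMod.isPrimitive_stdAddChar N), ZMod.card]
  split_ifs <;> simp

theorem card_ker_red : Nat.card (red p).toAddMonoidHom.ker = p := by
  have h := (red p).toAddMonoidHom.ker.card_mul_index
  have hs : Function.Surjective (red p).toAddMonoidHom :=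
    ZMod.castHom_surjective (dvd_pow_self p two_ne_zero)
  rw [AddSubgroup.index_ker, AddMonoidHom.range_eq_top.2 hs, AddSubgroup.card_top,
    Nat.card_zmod, Nat.card_zmod] at h
  exact Nat.eq_of_mul_eq_mul_right hp.out.pos (h.trans (sq p))

/-- Orthogonality of characters on the subgroup pR: the character attached to `y` is trivial there
exactly when p kills `y`, so pR is its own annihilator. -/
theorem sum_ker_red (y : ZMod (p ^ 2)) :
    ∑ t : ZMod (p ^ 2), (if red p t = 0 then (1 : ℂ) else 0) * ZMod.stdAddChar (t * y)
      = if red p y = 0 then (p : ℂ) else 0 := by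
  classical
  let K := (red p).toAddMonoidHom.ker
  let χ : AddChar K ℂ := (AddChar.mulShift ZMod.stdAddChar y).compAddMonoidHom K.subtype
  have hχ (t : K) : χ t = ZMod.stdAddChar ((t : ZMod (p ^ 2)) * y) := by
    simp [χ, AddChar.mulShift_apply, mul_comm]
  have h0 : χ = 0 ↔ red p y = 0 := by
    constructor
    · intro h
      have := DFunLike.congr_fun h ⟨(p : ZMod (p ^ 2)), by simp [K, AddMonoidHom.mem_ker]⟩
      rw [hχ, AddChar.zero_apply, ← AddChar.map_zero_eq_one (ZMod.stdAddChar (N := p ^ 2))] at this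
      exact (mul_eq_zero_iff_red y).1 (ZMod.injective_stdAddChar (N := p ^ 2) this)
    · intro h
      ext t
      rw [hχ, mul_eq_zero_of_red t.2 h]
      simp
  have hsum := AddChar.sum_eq_ite χ
  rw [if_congr h0 rfl rfl, ← Nat.card_eq_fintype_card, card_ker_red] at hsum
  rw [← hsum]
  simp only [ite_mul, one_mul, zero_mul]
  rw [← Finset.sum_filter]
  refine (Finset.sum_subtype _ (fun t => ?_) _).trans (Finset.sum_congr rfl fun t _ => (hχ t).symm)
  simp [K, AddMonoidHom.mem_ker]

theorem sum_bot {N : ℕ} [NeZero N] (y : ZMod N) :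
    ∑ t : ZMod N, (if t = 0 then (1 : ℂ) else 0) * ZMod.stdAddChar (t * y) = 1 := by
  simp

variable (hp3 : p ≠ 3)
include hp3

theorem coprime_three : Nat.Coprime 3 (p ^ 2) :=
  Nat.Coprime.pow_right 2 ((Nat.coprime_primes Nat.prime_three hp.out).2 hp3.symm)

theorem isUnit_inv_three : IsUnit (3⁻¹ : ZMod (p ^ 2)) := by
  refine IsUnit.of_mul_eq_one 3 ?_
  rw [mul_comm]
  simpa using ZMod.coe_mul_inv_eq_one 3 (coprime_three hp3)

open Classical

/-- Free coordinates dualize to zero ones, pR to itself, and ι reverses the order of coordinates.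
The constant is p⁻⁸ · p² · p² · p. -/
theorem fourierV_nonmaximalAt (b : Form (ZMod (p ^ 2))) :
    fourierV (fun a => if a ∈ nonmaximalAt p then 1 else 0) b
      = if b ∈ strongTripleRoot p then (p : ℂ) ^ (-3 : ℤ) else 0 := by
  have hu := isUnit_inv_three hp3
  have hu' := (isUnit_iff_red _).1 hu
  have h := fourier_box (fun _ => True) (fun _ => True) (fun t => red p t = 0) (fun t => t = 0)
    (iotaInv b)
  have h0 : (p : ℂ) ≠ 0 := Nat.cast_ne_zero.2 hp.out.ne_zero
  rw [sum_top, sum_top, sum_ker_red, sum_bot] at h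
  simp only [true_and] at h
  have hm (a : Form (ZMod (p ^ 2))) : a ∈ nonmaximalAt p ↔ red p (a 2) = 0 ∧ a 3 = 0 := Iff.rfl
  simp only [hm]
  refine h.trans ?_
  simp only [iotaInv, Matrix.cons_val, map_mul, map_neg, neg_eq_zero, mul_eq_zero, hu', false_or,
    hu.mul_right_eq_zero]
  by_cases h1 : red p (b 1) = 0 <;> by_cases h2 : b 2 = 0 <;> by_cases h3 : b 3 = 0 <;>
    simp [strongTripleRoot, h1, h2, h3]
  field_simp

theorem fourierV_nonmaximalAt_inter (b : Form (ZMod (p ^ 2))) :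
    fourierV (fun a => if a ∈ nonmaximalAt p ∩ pV p then 1 else 0) b
      = if b ∈ tripleRoot p then (p : ℂ) ^ (-5 : ℤ) else 0 := by
  have hu' := (isUnit_iff_red _).1 (isUnit_inv_three hp3)
  have h := fourier_box (fun t => red p t = 0) (fun t => red p t = 0) (fun t => red p t = 0)
    (fun t => t = 0) (iotaInv b)
  have h0 : (p : ℂ) ≠ 0 := Nat.cast_ne_zero.2 hp.out.ne_zero
  rw [sum_ker_red, sum_ker_red, sum_ker_red, sum_bot] at h
  have hm (a : Form (ZMod (p ^ 2))) : a ∈ nonmaximalAt p ∩ pV p ↔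
      red p (a 0) = 0 ∧ red p (a 1) = 0 ∧ red p (a 2) = 0 ∧ a 3 = 0 := by
    rw [Set.mem_inter_iff, mem_pV_iff_four]
    constructor
    · rintro ⟨⟨_, h3⟩, h0, h1, h2, _⟩
      exact ⟨h0, h1, h2, h3⟩
    · rintro ⟨h0, h1, h2, h3⟩
      exact ⟨⟨h2, h3⟩, h0, h1, h2, by simp [h3]⟩
  simp only [hm]
  refine h.trans ?_
  simp only [iotaInv, Matrix.cons_val, map_mul, map_neg, neg_eq_zero, mul_eq_zero, hu', false_or]
  by_cases h1 : red p (b 1) = 0 <;> by_cases h2 : red p (b 2) = 0 <;>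
    by_cases h3 : red p (b 3) = 0 <;> simp [tripleRoot, h1, h2, h3]
  field_simp

theorem fourierV_pV (b : Form (ZMod (p ^ 2))) :
    fourierV (fun a => if a ∈ pV p then 1 else 0) b
      = if b ∈ pV p then (p : ℂ) ^ (-4 : ℤ) else 0 := by
  have hu' := (isUnit_iff_red _).1 (isUnit_inv_three hp3)
  have h := fourier_box (fun t => red p t = 0) (fun t => red p t = 0) (fun t => red p t = 0)
    (fun t => red p t = 0) (iotaInv b)
  have h0 : (p : ℂ) ≠ 0 := Nat.cast_ne_zero.2 hp.out.ne_zero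
  simp only [sum_ker_red] at h
  simp only [mem_pV_iff_four]
  refine h.trans ?_
  simp only [iotaInv, Matrix.cons_val, map_mul, map_neg, neg_eq_zero, mul_eq_zero, hu', false_or]
  by_cases h1 : red p (b 1) = 0 <;> by_cases h2 : red p (b 2) = 0 <;>
    by_cases h3 : red p (b 3) = 0 <;> by_cases h0 : red p (b 0) = 0 <;> simp [h0, h1, h2, h3]
  field_simp

theorem fourierV_act (f : Form (ZMod (p ^ 2)) → ℂ)
    {g : Matrix.GeneralLinearGroup (Fin 2) (ZMod (p ^ 2))}
    (hg : Matrix.GeneralLinearGroup.det g = 1) (b : Form (ZMod (p ^ 2))) :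
    fourierV (fun a => f (act g a)) b = fourierV f (act g b) := by
  unfold fourierV fourier
  congr 1
  refine Fintype.sum_equiv (actEquiv g) _ _ fun a => ?_
  have := pairing_act (coprime_three hp3) g a b
  rw [hg, Units.val_one, one_mul] at this
  simp [actEquiv, this]

end Fourier

/-! ### Double roots of forms over a field -/

section Roots

variable {F : Type*} [Field F]

theorem rootMult_zero (P : Projectivization F (Fin 2 → F)) : rootMult (0 : Form F) P = ⊤ := by
  simp [rootMult, toPoly]

theorem eval_toPoly (x : Form F) (w : Fin 2 → F) : MvPolynomial.eval w (toPoly x)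
    = x 0 * w 0 ^ 3 + x 1 * w 0 ^ 2 * w 1 + x 2 * w 0 * w 1 ^ 2 + x 3 * w 1 ^ 3 := by
  simp [toPoly]

theorem eval_eq_zero_of_rootMult_ne_zero {x : Form F} {P : Projectivization F (Fin 2 → F)}
    (h : rootMult x P ≠ 0) : MvPolynomial.eval P.rep (toPoly x) = 0 := by
  rw [rootMult, emultiplicity_ne_zero] at h
  obtain ⟨q, hq⟩ := h
  rw [hq]
  simp [mul_comm]

theorem eval_pderiv_eq_zero_of_two_le_rootMult {x : Form F} {P : Projectivization F (Fin 2 → F)}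
    (h : 2 ≤ rootMult x P) (i : Fin 2) :
    MvPolynomial.eval P.rep (MvPolynomial.pderiv i (toPoly x)) = 0 := by
  obtain ⟨q, hq⟩ := pow_dvd_of_le_emultiplicity (k := 2) (by exact_mod_cast h)
  rw [hq, MvPolynomial.pderiv_mul, MvPolynomial.pderiv_pow]
  simp [mul_comm]

theorem eq_of_rep_mul_eq {P Q : Projectivization F (Fin 2 → F)}
    (h : P.rep 0 * Q.rep 1 = P.rep 1 * Q.rep 0) : P = Q := by
  rw [← P.mk_rep, ← Q.mk_rep, Projectivization.mk_eq_mk_iff']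
  by_cases h0 : Q.rep 0 = 0
  · have h1 : Q.rep 1 ≠ 0 := fun h1 => Q.rep_nonzero (by ext i; fin_cases i <;> simp [h0, h1])
    refine ⟨P.rep 1 / Q.rep 1, ?_⟩
    ext i
    fin_cases i
    · simp only [Fin.zero_eta, Pi.smul_apply, smul_eq_mul]
      field_simp
      linear_combination -h
    · simp [h1]
  · refine ⟨P.rep 0 / Q.rep 0, ?_⟩
    ext i
    fin_cases i
    · simp [h0]
    · simp only [Fin.mk_one, Pi.smul_apply, smul_eq_mul]
      field_simp
      linear_combination h

theorem eq_of_linear_eq_zero {a b : F} (hab : a ≠ 0 ∨ b ≠ 0)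
    {P Q : Projectivization F (Fin 2 → F)} (hP : a * P.rep 0 + b * P.rep 1 = 0)
    (hQ : a * Q.rep 0 + b * Q.rep 1 = 0) : P = Q := by
  apply eq_of_rep_mul_eq
  rcases hab with h | h <;> refine mul_left_cancel₀ h ?_
  · linear_combination Q.rep 1 * hP - P.rep 1 * hQ
  · linear_combination P.rep 0 * hQ - Q.rep 0 * hP

theorem exists_two_le_rootMult {x : Form F} {a b : F} (hab : a ≠ 0 ∨ b ≠ 0)
    (h : (MvPolynomial.C a * MvPolynomial.X 0 + MvPolynomial.C b * MvPolynomial.X 1) ^ 2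
      ∣ toPoly x) : ∃ P, 2 ≤ rootMult x P ∧ a * P.rep 0 + b * P.rep 1 = 0 := by
  have hv : (![-b, a] : Fin 2 → F) ≠ 0 := by
    intro h0
    have e0 := congrFun h0 0
    have e1 := congrFun h0 1
    simp at e0 e1
    simp [e0, e1] at hab
  obtain ⟨k, hk⟩ := Projectivization.exists_smul_eq_mk_rep F _ hv
  refine ⟨Projectivization.mk F _ hv, ?_, ?_⟩
  · have := le_emultiplicity_of_pow_dvd (k := 2) (a := MvPolynomial.C ((k : F) * a) *
      MvPolynomial.X (0 : Fin 2) - MvPolynomial.C ((k : F) * -b) * MvPolynomial.X 1)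
      (b := toPoly x) (by
        refine dvd_trans ⟨MvPolynomial.C ((k : F)⁻¹ ^ 2), ?_⟩ h
        have hk1 : (MvPolynomial.C (k : F) * MvPolynomial.C (k : F)⁻¹ : MvPolynomial (Fin 2) F)
            = 1 := by
          rw [← MvPolynomial.C_mul]
          simp
        simp only [MvPolynomial.C_mul, MvPolynomial.C_neg, MvPolynomial.C_pow]
        linear_combination (-(MvPolynomial.C a * MvPolynomial.X 0
          + MvPolynomial.C b * MvPolynomial.X 1) ^ 2)
          * (MvPolynomial.C (k : F) * MvPolynomial.C (k : F)⁻¹ + 1) * hk1)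
    simpa [rootMult, ← hk, Units.smul_def] using this
  · simp only [← hk, Units.smul_def, Pi.smul_apply, smul_eq_mul, Matrix.cons_val_zero,
      Matrix.cons_val_one]
    ring

/-- The zero of the squared factor has multiplicity at least 2, and every simple root is a zero of
the other linear factor, so there is at most one. -/
theorem not_type111_of_sq_dvd {x : Form F} {a b c d : F} (hab : a ≠ 0 ∨ b ≠ 0)
    (h : toPoly x = (MvPolynomial.C a * MvPolynomial.X 0 + MvPolynomial.C b * MvPolynomial.X 1) ^ 2
      * (MvPolynomial.C c * MvPolynomial.X 0 + MvPolynomial.C d * MvPolynomial.X 1)) :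
    x ∉ type111 F ∪ type21 F ∪ type3 F := by
  obtain ⟨P₀, hm, hP₀⟩ := exists_two_le_rootMult hab (Dvd.intro _ h.symm)
  have hne {P} (hP : rootMult x P = 1) : P ≠ P₀ := by
    rintro rfl
    rw [hP] at hm
    exact absurd hm (by decide)
  rintro ((⟨P, Q, S, hPQ, -, -, hP, hQ, -⟩ | ⟨P, hP, hall⟩) | hall)
  · have hcd : c ≠ 0 ∨ d ≠ 0 := by
      by_contra! hcd
      rw [rootMult, h, hcd.1, hcd.2] at hP
      simp at hP
    have key {P} (hP : rootMult x P = 1) : c * P.rep 0 + d * P.rep 1 = 0 := by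
      have := eval_eq_zero_of_rootMult_ne_zero (x := x) (P := P) (by simp [hP])
      rw [h] at this
      simp only [map_mul, map_pow, map_add, MvPolynomial.eval_C, MvPolynomial.eval_X] at this
      exact (mul_eq_zero.1 this).resolve_left
        (pow_ne_zero 2 fun h0 => hne hP (eq_of_linear_eq_zero hab h0 hP₀))
    exact hPQ (eq_of_linear_eq_zero hcd (key hP) (key hQ))
  · rw [hall P₀ (hne hP).symm] at hm
    exact absurd hm (by decide)
  · rw [hall P₀] at hm
    exact absurd hm (by decide)

end Roots

/-! ### Double roots of the reduction modulo p. -/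

section Reduction

variable {p : ℕ} [hp : Fact p.Prime]

theorem reduce_apply (x : Form (ZMod (p ^ 2))) (i : Fin 4) : reduce p x i = red p (x i) := rfl

theorem reduce_eq_zero_iff (x : Form (ZMod (p ^ 2))) : reduce p x = 0 ↔ x ∈ pV p := by
  rw [mem_pV_iff]
  exact funext_iff

theorem exists_lower_row {s t : ZMod (p ^ 2)} (h : red p s ≠ 0 ∨ red p t ≠ 0) :
    ∃ g : Matrix.GeneralLinearGroup (Fin 2) (ZMod (p ^ 2)), g.1 1 0 = s ∧ g.1 1 1 = t := by
  rcases h with h | h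
  · refine ⟨Matrix.GeneralLinearGroup.mk'' !![0, 1; s, t] ?_, rfl, rfl⟩
    simpa [isUnit_iff_red] using h
  · refine ⟨Matrix.GeneralLinearGroup.mk'' !![1, 0; s, t] ?_, rfl, rfl⟩
    simpa [isUnit_iff_red] using h

theorem mem_saturation_doubleRoot {x : Form (ZMod (p ^ 2))}
    {P : Projectivization (ZMod p) (Fin 2 → ZMod p)} (h : 2 ≤ rootMult (reduce p x) P) :
    x ∈ saturation (doubleRoot p) := by
  have hs : Function.Surjective (red p) := ZMod.castHom_surjective (dvd_pow_self p two_ne_zero)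
  obtain ⟨s, hs0⟩ := hs (P.rep 0)
  obtain ⟨t, ht0⟩ := hs (P.rep 1)
  have hst : red p s ≠ 0 ∨ red p t ≠ 0 := by
    by_contra! h0
    rw [hs0, ht0] at h0
    exact P.rep_nonzero (by ext i; fin_cases i <;> simp [h0])
  obtain ⟨g, hg0, hg1⟩ := exists_lower_row hst
  have e := eval_eq_zero_of_rootMult_ne_zero (x := reduce p x) (P := P) (by
    intro h0
    rw [h0] at h
    exact absurd h (by decide))
  have e0 := eval_pderiv_eq_zero_of_two_le_rootMult h 0
  have e1 := eval_pderiv_eq_zero_of_two_le_rootMult h 1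
  rw [eval_toPoly] at e
  simp [toPoly, MvPolynomial.pderiv_X] at e0 e1
  simp only [reduce_apply, ← hs0, ← ht0] at e e0 e1
  -- Up to the determinant, the last two coefficients of `act g x` modulo p are the derivative of
  -- the form at P along the upper row of `g`, and its value at P.
  refine (mem_saturation_iff _ x).2 ⟨g, ?_, ?_⟩ <;>
    simp only [act, Matrix.cons_val, map_mul, map_add, map_pow, map_ofNat, hg0, hg1]
  · linear_combination
      red p (((Matrix.GeneralLinearGroup.det g)⁻¹ : (ZMod (p ^ 2))ˣ) : ZMod (p ^ 2))
        * (red p (g.1 0 0) * e0 + red p (g.1 0 1) * e1)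
  · linear_combination
      red p (((Matrix.GeneralLinearGroup.det g)⁻¹ : (ZMod (p ^ 2))ˣ) : ZMod (p ^ 2)) * e

theorem mem_saturation_doubleRoot_of_type {x : Form (ZMod (p ^ 2))}
    (h : reduce p x ∈ type1cubed (ZMod p) ∪ type1sq1 (ZMod p)) :
    x ∉ pV p ∧ x ∈ saturation (doubleRoot p) := by
  have : ∃ P, 2 ≤ rootMult (reduce p x) P ∧ rootMult (reduce p x) P ≠ ⊤ := by
    rcases h with ⟨P, hP⟩ | ⟨P, -, -, hP, -⟩
    · exact ⟨P, by rw [hP]; decide, by rw [hP]; decide⟩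
    · exact ⟨P, by rw [hP], by rw [hP]; decide⟩
  obtain ⟨P, h2, ht⟩ := this
  refine ⟨fun hV => ht ?_, mem_saturation_doubleRoot h2⟩
  rw [(reduce_eq_zero_iff x).2 hV, rootMult_zero]

theorem not_mem_saturation_doubleRoot_of_type {x : Form (ZMod (p ^ 2))}
    (h : reduce p x ∈ type111 (ZMod p) ∪ type21 (ZMod p) ∪ type3 (ZMod p)) :
    x ∉ pV p ∧ x ∉ saturation (doubleRoot p) := by
  have hD : x ∉ saturation (doubleRoot p) := by
    rintro ⟨g, d, ⟨h2, h3⟩, rfl⟩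
    have hd := congrArg (red p) (det_inv_mul g)
    simp only [map_mul, map_sub, map_one] at hd
    have hab : red p (g.1 0 0) ≠ 0 ∨ red p (g.1 1 0) ≠ 0 := by
      by_contra! h0
      simp [h0.1, h0.2] at hd
    set e := (((Matrix.GeneralLinearGroup.det g)⁻¹ : (ZMod (p ^ 2))ˣ) : ZMod (p ^ 2)) with he
    -- Modulo p, `d` is u² (d₀ u + d₁ v); substituting the columns of `g` gives the two linear
    -- factors.
    refine not_type111_of_sq_dvd hab
      (c := red p (e * (d 0 * g.1 0 0 + d 1 * g.1 0 1)))
      (d := red p (e * (d 0 * g.1 1 0 + d 1 * g.1 1 1))) ?_ h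
    simp only [toPoly, reduce_apply, act, ← he, Matrix.cons_val, map_mul, map_add, map_pow, h2, h3,
      map_ofNat, map_zero]
    ring
  refine ⟨fun hV => hD (mem_saturation_of_mem ?_), hD⟩
  rw [mem_pV_iff_four] at hV
  exact hV.2.2

end Reduction

/-! ### The Fourier transform of `Φ_p` -/

section Main

variable {p : ℕ} [hp : Fact p.Prime]

theorem fourierV_add {N : ℕ} [NeZero N] (f g : Form (ZMod N) → ℂ) (b : Form (ZMod N)) :
    fourierV (fun a => f a + g a) b = fourierV f b + fourierV g b := by
  simp [fourierV, fourier, add_mul, Finset.sum_add_distrib, mul_add]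

theorem fourierV_sub {N : ℕ} [NeZero N] (f g : Form (ZMod N) → ℂ) (b : Form (ZMod N)) :
    fourierV (fun a => f a - g a) b = fourierV f b - fourierV g b := by
  simp [fourierV, fourier, sub_mul, Finset.sum_sub_distrib, mul_sub]

theorem fourierV_sum {N : ℕ} [NeZero N] {ι : Type*} (s : Finset ι) (f : ι → Form (ZMod N) → ℂ)
    (b : Form (ZMod N)) : fourierV (fun a => ∑ i ∈ s, f i a) b = ∑ i ∈ s, fourierV (f i) b := by
  simp only [fourierV, fourier, Finset.sum_mul]
  rw [Finset.sum_comm, Finset.mul_sum]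

open Classical in
theorem fourierV_Phi (hp3 : p ≠ 3) (b : Form (ZMod (p ^ 2))) :
    fourierV (Phi p) b = (if b ∈ pV p then (p : ℂ) ^ (-4 : ℤ) else 0)
      + ((p : ℂ) ^ (-3 : ℤ) * (∑ P, if act (pointGL p P) b ∈ strongTripleRoot p then 1 else 0)
      - (p : ℂ) ^ (-5 : ℤ) * ∑ P, if act (pointGL p P) b ∈ tripleRoot p then 1 else 0) := by
  rw [funext Phi_eq, fourierV_add, fourierV_sum, fourierV_pV hp3, Finset.mul_sum, Finset.mul_sum,
    ← Finset.sum_sub_distrib]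
  refine congrArg _ (Finset.sum_congr rfl fun P _ => ?_)
  rw [fourierV_sub, fourierV_act hp3 (fun a => if a ∈ nonmaximalAt p then 1 else 0)
    (det_pointGL P), fourierV_act hp3 (fun a => if a ∈ nonmaximalAt p ∩ pV p then 1 else 0)
    (det_pointGL P), fourierV_nonmaximalAt hp3, fourierV_nonmaximalAt_inter hp3]
  simp only [mul_ite, mul_one, mul_zero]

-- Every point counts for `tripleRoot p`, and p⁻⁴ - (p + 1) p⁻⁵ = -p⁻⁵; `strongTripleRoot p` for pc
-- is `doubleRoot p` for c.
open Classical in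
theorem fourierV_Phi_smul (hp3 : p ≠ 3) (c : Form (ZMod (p ^ 2))) :
    fourierV (Phi p) ((p : ZMod (p ^ 2)) • c) = (p : ℂ) ^ (-3 : ℤ)
      * (∑ P, if act (pointGL p P) c ∈ doubleRoot p then 1 else 0) - (p : ℂ) ^ (-5 : ℤ) := by
  have h0 : (p : ℂ) ≠ 0 := Nat.cast_ne_zero.2 hp.out.ne_zero
  have hS (x : Form (ZMod (p ^ 2))) :
      (p : ZMod (p ^ 2)) • x ∈ strongTripleRoot p ↔ x ∈ doubleRoot p := by
    simp [strongTripleRoot, doubleRoot, mul_eq_zero_iff_red]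
  have hT (x : Form (ZMod (p ^ 2))) : (p : ZMod (p ^ 2)) • x ∈ tripleRoot p := by
    simp [tripleRoot]
  have hV : (p : ZMod (p ^ 2)) • c ∈ pV p := ⟨c, rfl⟩
  simp only [fourierV_Phi hp3, act_smul, hS, hT, hV, if_true, Finset.sum_const, Finset.card_univ,
    Fintype.card_option, ZMod.card, nsmul_eq_mul, mul_one, Nat.cast_add, Nat.cast_one]
  have h45 : (p : ℂ) ^ (-4 : ℤ) = (p : ℂ) ^ (-5 : ℤ) * p := by
    rw [← zpow_add_one₀ h0]
    norm_num
  rw [h45]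
  ring

open Classical in
theorem fourierV_Phi_of_not_mem (hp3 : p ≠ 3) {b : Form (ZMod (p ^ 2))} (hV : b ∉ pV p) :
    fourierV (Phi p) b
      = (p : ℂ) ^ (-3 : ℤ) * (if b ∈ saturation (strongTripleRoot p) then 1 else 0)
        - (p : ℂ) ^ (-5 : ℤ) * (if b ∈ saturation (tripleRoot p) then 1 else 0) := by
  rw [fourierV_Phi hp3, if_neg hV, zero_add,
    sum_pointGL iwahoriStable_strongTripleRoot strongTripleRoot_subset hV,
    sum_pointGL iwahoriStable_tripleRoot tripleRoot_subset hV]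

end Main

end BinaryCubic

theorem mainTheorem2 (p : ℕ) [Fact p.Prime] (hp2 : p ≠ 2) (hp3 : p ≠ 3) :
    (∀ c : BinaryCubic.Form (ZMod (p ^ 2)),
      (BinaryCubic.reduce p c ∈ BinaryCubic.type0 (ZMod p) →
        BinaryCubic.fourierV (BinaryCubic.Phi p) ((p : ZMod (p ^ 2)) • c)
          = (p : ℂ) ^ (-2 : ℤ) + (p : ℂ) ^ (-3 : ℤ) - (p : ℂ) ^ (-5 : ℤ)) ∧
      (BinaryCubic.reduce p c ∈ BinaryCubic.type1cubed (ZMod p) ∪ BinaryCubic.type1sq1 (ZMod p) →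
        BinaryCubic.fourierV (BinaryCubic.Phi p) ((p : ZMod (p ^ 2)) • c)
          = (p : ℂ) ^ (-3 : ℤ) - (p : ℂ) ^ (-5 : ℤ)) ∧
      (BinaryCubic.reduce p c ∈ BinaryCubic.type111 (ZMod p) ∪ BinaryCubic.type21 (ZMod p)
          ∪ BinaryCubic.type3 (ZMod p) →
        BinaryCubic.fourierV (BinaryCubic.Phi p) ((p : ZMod (p ^ 2)) • c)
          = -(p : ℂ) ^ (-5 : ℤ))) ∧
    (∀ b : BinaryCubic.Form (ZMod (p ^ 2)), b ∉ BinaryCubic.pV p →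
      (b ∈ BinaryCubic.type1cubedStarStar p →
        BinaryCubic.fourierV (BinaryCubic.Phi p) b
          = (p : ℂ) ^ (-3 : ℤ) - (p : ℂ) ^ (-5 : ℤ)) ∧
      (b ∈ BinaryCubic.type1cubedStar p ∪ BinaryCubic.type1cubedMax p →
        BinaryCubic.fourierV (BinaryCubic.Phi p) b = -(p : ℂ) ^ (-5 : ℤ)) ∧
      (b ∉ BinaryCubic.type1cubedStarStar p ∪ BinaryCubic.type1cubedStar p
          ∪ BinaryCubic.type1cubedMax p →
        BinaryCubic.fourierV (BinaryCubic.Phi p) b = 0)) := by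
  classical
  open BinaryCubic in
  refine ⟨fun c => ⟨fun h => ?_, fun h => ?_, fun h => ?_⟩,
    fun b hV => ⟨fun h => ?_, fun h => ?_, fun h => ?_⟩⟩
  · have h0 : (p : ℂ) ≠ 0 := Nat.cast_ne_zero.2 (Fact.out : p.Prime).ne_zero
    -- All p + 1 points count for the zero form, giving (p + 1) p⁻³ = p⁻² + p⁻³.
    have hc (P : Option (ZMod p)) : act (pointGL p P) c ∈ doubleRoot p :=
      (((mem_pV_iff_four _).1 (act_mem_pV _ ((reduce_eq_zero_iff c).1 h))).2.2)
    have h23 : (p : ℂ) ^ (-2 : ℤ) = (p : ℂ) ^ (-3 : ℤ) * p := by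
      rw [← zpow_add_one₀ h0]
      norm_num
    simp only [fourierV_Phi_smul hp3, hc, if_true, Finset.sum_const, Finset.card_univ,
      Fintype.card_option, ZMod.card, nsmul_eq_mul, mul_one, Nat.cast_add, Nat.cast_one]
    rw [h23]
    ring
  · obtain ⟨hV, hD⟩ := mem_saturation_doubleRoot_of_type h
    rw [fourierV_Phi_smul hp3, sum_pointGL iwahoriStable_doubleRoot subset_rfl hV, if_pos hD,
      mul_one]
  · obtain ⟨hV, hD⟩ := not_mem_saturation_doubleRoot_of_type h
    rw [fourierV_Phi_smul hp3, sum_pointGL iwahoriStable_doubleRoot subset_rfl hV, if_neg hD,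
      mul_zero, zero_sub]
  · have hS := (type1cubedStarStar_eq b hV).1 h
    rw [fourierV_Phi_of_not_mem hp3 hV, if_pos hS,
      if_pos (saturation_mono strongTripleRoot_subset_tripleRoot hS), mul_one, mul_one]
  · rw [fourierV_Phi_of_not_mem hp3 hV, if_neg (not_mem_strongTripleRoot_of_star_or_max h),
      if_pos (type1cubedStar_or_max_subset h), mul_one, mul_zero, zero_sub]
  · have hT := fun hT => h (mem_of_mem_saturation_tripleRoot hV hT)
    have hS := fun hS => hT (saturation_mono strongTripleRoot_subset_tripleRoot hS)
    rw [fourierV_Phi_of_not_mem hp3 hV, if_neg hS, if_neg hT, mul_zero, mul_zero, sub_zero]
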